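/- Let $\widetilde{\mathfrak R}$ be the set of real symmetric, entrywise nonnegative $5\times5$ matrices with trace zero. A list $\sigma=(\lambda_1,\dots,\lambda_5)$ of real numbers is called a normalized spectrum of $A\in\widetilde{\mathfrak R}$ if $\lambda_1,\dots,\lambda_5$ are the eigenvalues of $A$, listed with multiplicity, and $1=\lambda_1\ge\lambda_2\ge\lambda_3\ge\lambda_4\ge\lambda_5\ge-1$. For real $d$ put $$A=\left(\tfrac d3,\tfrac d3\right),\quad B=\left(d+\tfrac12,d+\tfrac12\right),\quad C=(3d+2,-d-1),\quad F=(d+1,d),\quad G=\left(d+1,-\tfrac12\right),$$ and, for $d\in\left[-\tfrac34+\tfrac{\sqrt5}4,0\right]$, $$H=(f(d),f(d)),\qquad I=\left(d+\tfrac12+g(d),\,d+\tfrac12-g(d)\right),$$ where (with real cube roots) $$r(d)=4d^3+27d^2+27d+3\sqrt3\sqrt{d^2(d+1)(8d^2+27d+27)},$$ $$f(d)=\frac23d-\frac{\sqrt[3]{4}\,d^2}{3\sqrt[3]{r(d)}}-\frac{\sqrt[3]{r(d)}}{3\sqrt[3]{4}}\quad(d<0),\qquad f(0)=0,$$ $$g(d)=\sqrt{\frac{\left(d-\left(-\frac34+\frac{\sqrt5}4\right)\right)\left(d-\left(-\frac34-\frac{\sqrt5}4\right)\right)}{2d+1}}.$$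 For such $d$ put $$h(t)=-\frac12(t-d)+\frac12\sqrt{\frac{t^3+dt^2-d^2t-4d-4d^2-d^3}{t-d}}$$ (with $h(0)=0$ when $d=0$), and let $P$ be the closed region with vertices $A,H,I,F,G$ bounded by the line segments $AH$, $IF$, $FG$, $GA$ and the curved edge from $H$ to $I$ given by $\gamma(t)=(x(t),h(x(t)))$, $x(t)=(1-t)f(d)+t\left(d+\tfrac12+g(d)\right)$, $t\in[0,1]$; that is, $P$ consists of all points lying on a vertical segment from a point of the edge $AG$ up to a point of $AH\cup\gamma([0,1])\cup IF$. **Theorem.** Let $d,x,y$ be real numbers with $d\in\left[-\tfrac34,0\right]$, and let $\sigma=(1,x,y,d-x-y,-d-1)$. a) If $d\in\left[-\tfrac34,-\tfrac12\right]$, then $\sigma$ is a normalized spectrum of some matrix in $\widetilde{\mathfrak R}$ if and only if $(x,y)$ lies in the (closed, possibly degenerate) triangle $ABC$. b) If $d\in\left[-\tfrac12,-\tfrac34+\tfrac{\sqrt5}4\right]$, then $\sigma$ is a normalized spectrum of some matrix in $\widetilde{\mathfrak R}$ if and only if $(x,y)$ lies in the (closed, possibly degenerate) quadrangle $ABFG$.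 c) If $d\in\left[-\tfrac34+\tfrac{\sqrt5}4,0\right]$, then $\sigma$ is a normalized spectrum of some matrix in $\widetilde{\mathfrak R}$ if and only if $(x,y)$ lies in $P$. -/

import Mathlib

namespace SNIEP

/-- The set of trace zero symmetric (entrywise) nonnegative real `5 × 5` matrices. -/
def TraceZeroSymmNonneg : Set (Matrix (Fin 5) (Fin 5) ℝ) :=
  {A | A.IsSymm ∧ (∀ i j, 0 ≤ A i j) ∧ A.trace = 0}

/-- `lam = (λ₁, …, λ₅)` is the normalized spectrum of `A`: it lists the eigenvalues of `A` with
their algebraic multiplicities, and `1 = λ₁ ≥ λ₂ ≥ λ₃ ≥ λ₄ ≥ λ₅ ≥ -1`. -/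
def IsNormalizedSpectrum (A : Matrix (Fin 5) (Fin 5) ℝ) (lam : Fin 5 → ℝ) : Prop :=
  A.charpoly = ∏ i, (Polynomial.X - Polynomial.C (lam i)) ∧
    lam 0 = 1 ∧ Antitone lam ∧ -1 ≤ lam 4

/-- The real cube root, on all of `ℝ`. -/
noncomputable def cbrt (x : ℝ) : ℝ := Real.sign x * |x| ^ (1 / 3 : ℝ)

theorem cbrt_pow_three (x : ℝ) : cbrt x ^ 3 = x := by
  have h : (|x| ^ (1 / 3 : ℝ)) ^ 3 = |x| := by
    rw [← Real.rpow_natCast, ← Real.rpow_mul (abs_nonneg x)]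
    norm_num
  unfold cbrt
  rw [mul_pow, h]
  rcases lt_trichotomy x 0 with hx | hx | hx
  · rw [Real.sign_of_neg hx, abs_of_neg hx]; ring
  · simp [hx]
  · rw [Real.sign_of_pos hx, abs_of_pos hx]; ring

noncomputable def r (d : ℝ) : ℝ :=
  4 * d ^ 3 + 27 * d ^ 2 + 27 * d +
    3 * √3 * √(d ^ 2 * (d + 1) * (8 * d ^ 2 + 27 * d + 27))

/-- At `d = 0` the formula reads `0 / 0`; there `f` takes its limit value `0`. -/
noncomputable def f (d : ℝ) : ℝ :=
  if d = 0 then 0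
  else 2 / 3 * d - cbrt 4 * d ^ 2 / (3 * cbrt (r d)) - cbrt (r d) / (3 * cbrt 4)

noncomputable def g (d : ℝ) : ℝ :=
  √((d - (-3 / 4 + √5 / 4)) * (d - (-3 / 4 - √5 / 4)) / (2 * d + 1))

/-- On `[f d, d + 1/2 + g d]` the denominator `t - d` vanishes only for `d = t = 0`, where the
formula evaluates to `0`, the value by continuity, as `h 0 t = 0` for all `t > 0`. -/
noncomputable def h (d t : ℝ) : ℝ :=
  -(1 / 2) * (t - d) +
    1 / 2 * √((t ^ 3 + d * t ^ 2 - d ^ 2 * t - 4 * d - 4 * d ^ 2 - d ^ 3) / (t - d))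

noncomputable def ptA (d : ℝ) : ℝ × ℝ := (d / 3, d / 3)

noncomputable def ptB (d : ℝ) : ℝ × ℝ := (d + 1 / 2, d + 1 / 2)

noncomputable def ptC (d : ℝ) : ℝ × ℝ := (3 * d + 2, -d - 1)

noncomputable def ptF (d : ℝ) : ℝ × ℝ := (d + 1, d)

noncomputable def ptG (d : ℝ) : ℝ × ℝ := (d + 1, -1 / 2)

noncomputable def ptH (d : ℝ) : ℝ × ℝ := (f d, f d)

noncomputable def ptI (d : ℝ) : ℝ × ℝ := (d + 1 / 2 + g d, d + 1 / 2 - g d)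

/-- The filled triangle `ABC`. -/
def triangleABC (d : ℝ) : Set (ℝ × ℝ) := convexHull ℝ {ptA d, ptB d, ptC d}

/-- The filled (convex) quadrangle `ABFG`. -/
def quadrangleABFG (d : ℝ) : Set (ℝ × ℝ) := convexHull ℝ {ptA d, ptB d, ptF d, ptG d}

/-- The curved edge from `H` to `I`. -/
noncomputable def γ (d t : ℝ) : ℝ × ℝ :=
  let u := (1 - t) * f d + t * (d + 1 / 2 + g d)
  (u, h d u)

/-- The upper boundary of `P`: the edge `AH`, the curved edge `HI` and the edge `IF`. -/
def upperBoundary (d : ℝ) : Set (ℝ × ℝ) :=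
  segment ℝ (ptA d) (ptH d) ∪ γ d '' Set.Icc 0 1 ∪ segment ℝ (ptI d) (ptF d)

/-- The closed region `P` with vertices `A, H, I, F, G` and edges `AH`, `γ`, `IF`, `FG`, `GA`.
The vertices `A, H, I, F` have increasing abscissas and the edge `FG` is vertical, so `P` consists
of the points that lie on a vertical segment from a point of the lower edge `AG` up to a point of
the upper boundary. -/
def P (d : ℝ) : Set (ℝ × ℝ) :=
  {p | ∃ y₀ y₁ : ℝ, (p.1, y₀) ∈ segment ℝ (ptA d) (ptG d) ∧ (p.1, y₁) ∈ upperBoundary d ∧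
    y₀ ≤ p.2 ∧ p.2 ≤ y₁}

end SNIEP

namespace SNIEP
open Polynomial

/-! Write `z = d - x - y` and `w = -d - 1`. For `-1 < d ≤ 0` one criterion governs all three cases:
`σ` is realizable iff it is ordered, `x + w ≤ 0`, and the sum of cubes is nonnegative (`0 ≤
thirdSymm d x y`). Necessity (`IsNormalizedSpectrum.inequalities`): the cubes sum to `tr A³`. Among
two orthogonal eigenvectors for `1` and `x > 0`, one forces an off-diagonal entry `≥ x`, and the
Rayleigh quotient on the difference of the two unit vectors then gives `w ≤ -x`. Sufficiency
(`exists_isNormalizedSpectrum`): matrices with a reflection symmetry split into a `2 × 2` and a `3 ×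
3` block, whose entries can be solved for according to the signs of `x` and `y`. In the plane, the
ordering cuts out the triangle `ABC`; the line `x = d + 1` matters once `d > -1/2`. The value of
`thirdSymm` at `B` is `-(4d² + 6d + 1)/4`, so the cubic curve starts to cut off `B` at `d = -3/4 +
√5/4`. -/

/-! ### Sufficiency: matrices with a reflection symmetry. -/

/-- The hollow matrices that commute with the reflection `1 ↔ 4`, `2 ↔ 3` fixing `0`. -/
def reflMatrix (p q r s t u : ℝ) : Matrix (Fin 5) (Fin 5) ℝ :=
  !![0, p, u, u, p;
     p, 0, q, r, t;
     u, q, 0, s, r;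
     u, r, s, 0, q;
     p, t, r, q, 0]

/-- The vectors `(0, a, b, -b, -a)` and `(c, a, b, b, a)` form invariant subspaces, which give the
quadratic and the cubic factor. -/
theorem charpoly_reflMatrix (p q r s t u : ℝ) :
    (reflMatrix p q r s t u).charpoly =
      (X ^ 2 + C (t + s) * X + C (t * s - (q - r) ^ 2)) *
        (X ^ 3 - C (t + s) * X ^ 2 + C (t * s - (q + r) ^ 2 - 2 * p ^ 2 - 2 * u ^ 2) * X
          - C (-2 * p ^ 2 * s + 4 * p * u * (q + r) - 2 * u ^ 2 * t)) := by
  have e : (reflMatrix p q r s t u).charmatrix =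
      !![X, -C p, -C u, -C u, -C p;
         -C p, X, -C q, -C r, -C t;
         -C u, -C q, X, -C s, -C r;
         -C u, -C r, -C s, X, -C q;
         -C p, -C t, -C r, -C q, X] := by
    ext1 i j
    fin_cases i <;> fin_cases j <;> simp [reflMatrix, Matrix.charmatrix]
  rw [Matrix.charpoly, e]
  simp only [map_sub, map_add, map_mul, map_pow, map_neg, map_ofNat]
  generalize C p = p, C q = q, C r = r, C s = s, C t = t, C u = u
  simp [Matrix.det_succ_row_zero, Fin.sum_univ_succ, Fin.succAbove]
  ring

theorem reflMatrix_mem {p q r s t u : ℝ} (hp : 0 ≤ p) (hq : 0 ≤ q) (hr : 0 ≤ r) (hs : 0 ≤ s)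
    (ht : 0 ≤ t) (hu : 0 ≤ u) : reflMatrix p q r s t u ∈ TraceZeroSymmNonneg := by
  refine ⟨?_, ?_, ?_⟩
  · ext i j
    fin_cases i <;> fin_cases j <;> rfl
  · intro i j
    fin_cases i <;> fin_cases j <;> simp [reflMatrix, *]
  · simp [reflMatrix, Matrix.trace, Fin.sum_univ_succ]

/-- The spectrum of `reflMatrix` consists of the eigenvalues `α`, `β` on the antisymmetric vectors
and the eigenvalues `κ`, `η`, `θ` on the symmetric vectors. -/
theorem charpoly_reflMatrix_eq {p q r s t u α β κ η θ : ℝ}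
    (h₁ : α + β = -(t + s)) (h₂ : α * β = t * s - (q - r) ^ 2) (h₃ : κ + η + θ = t + s)
    (h₄ : κ * η + κ * θ + η * θ = t * s - (q + r) ^ 2 - 2 * p ^ 2 - 2 * u ^ 2)
    (h₅ : κ * η * θ = -2 * p ^ 2 * s + 4 * p * u * (q + r) - 2 * u ^ 2 * t) :
    (reflMatrix p q r s t u).charpoly =
      (X - C α) * (X - C β) * ((X - C κ) * (X - C η) * (X - C θ)) := by
  rw [charpoly_reflMatrix, ← h₂, ← h₄, ← h₅]
  congr 1
  · rw [show t + s = -(α + β) by linarith]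
    simp only [map_add, map_mul, map_neg]
    ring
  · rw [← h₃]
    simp only [map_add, map_mul]
    ring

/-- The third elementary symmetric function of `(1, x, y, d - x - y, -d - 1)`, which is a third of
the sum of the cubes. -/
def thirdSymm (d x y : ℝ) : ℝ :=
  -(x - d) * (y ^ 2 + (x - d) * y) + d * x ^ 2 - d ^ 2 * x - d ^ 2 - d

/-- With `r = u = 0` the coefficient equations have one solution: `2p² = T`, `s = -xz/T`, `t = d + 1
- y - s`. Since `thirdSymm d x y = xz + (d + 1 - y) T` and `xz < 0`, the trace condition yields both
`T > 0` and `t ≥ 0`. -/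
theorem exists_charpoly_of_pos {d x y : ℝ} (hd : d ≤ 0) (hyx : y ≤ x)
    (hwz : -d - 1 ≤ d - x - y) (hy : 0 < y) (hs : 0 ≤ thirdSymm d x y) :
    ∃ A ∈ TraceZeroSymmNonneg, A.charpoly =
      (X - C y) * (X - C (-d - 1)) * ((X - C 1) * (X - C x) * (X - C (d - x - y))) := by
  obtain ⟨z, hz⟩ : ∃ z, z = d - x - y := ⟨_, rfl⟩
  rw [← hz]
  have hS : 0 < d + 1 - y := by linarith
  have hxz : 0 < -(x * z) := by nlinarith
  set T := y * (-d - 1) - x - z - x * z with hT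
  have e : thirdSymm d x y = x * z + (d + 1 - y) * T := by
    rw [hT, hz, thirdSymm]; ring
  have hTS : -(x * z) ≤ (d + 1 - y) * T := by linarith
  have hT0 : 0 < T := by
    by_contra! h
    nlinarith
  set s := -(x * z) / T with hsd
  have hs0 : 0 < s := by positivity
  have hsT : s * T = -(x * z) := div_mul_cancel₀ _ hT0.ne'
  have ht0 : 0 ≤ d + 1 - y - s := by
    rw [sub_nonneg, hsd, div_le_iff₀ hT0]; exact hTS
  have hq : 0 ≤ (d + 1 - y - s) * s - y * (-d - 1) := by nlinarith
  refine ⟨_, reflMatrix_mem (p := √(T / 2)) (q := √((d + 1 - y - s) * s - y * (-d - 1))) (r := 0)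
    (s := s) (t := d + 1 - y - s) (u := 0) (by positivity) (by positivity) le_rfl hs0.le ht0 le_rfl,
    charpoly_reflMatrix_eq ?_ ?_ ?_ ?_ ?_⟩
  · ring
  · rw [sub_zero, Real.sq_sqrt hq]; ring
  · rw [hz]; ring
  · rw [add_zero, Real.sq_sqrt hq, Real.sq_sqrt (by positivity), hT]; ring
  · rw [Real.sq_sqrt (by positivity)]; linarith

/-- Taking `q = r`, `s = -w`, `t = -z` makes the antisymmetric block diagonal. With `u = 0` the
determinant gives `p`, and the cubic factor takes the value `-4q²s` at `s`, which gives `q`; it is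
real because `x ≤ d + 1`. -/
theorem exists_charpoly_of_nonneg_of_nonpos {d x y : ℝ} (hd : -1 < d) (hd0 : d ≤ 0)
    (hzy : d - x - y ≤ y) (hwz : -d - 1 ≤ d - x - y) (hx : x ≤ d + 1) (hx0 : 0 ≤ x) (hy : y ≤ 0) :
    ∃ A ∈ TraceZeroSymmNonneg, A.charpoly =
      (X - C (d - x - y)) * (X - C (-d - 1)) * ((X - C 1) * (X - C x) * (X - C y)) := by
  have ha : 0 < d + 1 := by linarith
  have hp : 0 ≤ -(x * y) / (2 * (d + 1)) := div_nonneg (by nlinarith) (by positivity)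
  have hp' : -(x * y) / (2 * (d + 1)) * (2 * (d + 1)) = -(x * y) :=
    div_mul_cancel₀ _ (by positivity)
  have he : 0 ≤ (d + 1 - x) * (-d) * (d + 1 - y) / (4 * (d + 1)) :=
    div_nonneg (mul_nonneg (mul_nonneg (by linarith) (by linarith)) (by linarith)) (by positivity)
  refine ⟨_, reflMatrix_mem (p := √(-(x * y) / (2 * (d + 1))))
    (q := √((d + 1 - x) * (-d) * (d + 1 - y) / (4 * (d + 1))))
    (r := √((d + 1 - x) * (-d) * (d + 1 - y) / (4 * (d + 1))))
    (s := d + 1) (t := x + y - d) (u := 0) (by positivity) (by positivity) (by positivity) ha.le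
    (by linarith) le_rfl, charpoly_reflMatrix_eq ?_ ?_ ?_ ?_ ?_⟩
  · ring
  · ring
  · ring
  · rw [← two_mul, mul_pow, Real.sq_sqrt he, Real.sq_sqrt hp]
    field_simp
    ring
  · rw [Real.sq_sqrt hp]; linarith

/-- Again `q = r`, `s = -w`, `t = -z`. The choice of `e` gives `!![t, 2e; 2e, s]` the eigenvalues
`x` and `1 + y`, with `(2e, s - x)` an eigenvector for `1 + y`. Coupling the fixed coordinate along
this eigenvector keeps `x` and replaces `0, 1 + y` by `1, y`, once `k` is scaled so that the product
is `y`. -/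
theorem exists_charpoly_of_nonpos {d x y : ℝ} (hd : -1 < d) (hd0 : d ≤ 0)
    (hyx : y ≤ x) (hzy : d - x - y ≤ y) (hwz : -d - 1 ≤ d - x - y) (hx0 : x ≤ 0) :
    ∃ A ∈ TraceZeroSymmNonneg, A.charpoly =
      (X - C (d - x - y)) * (X - C (-d - 1)) * ((X - C 1) * (X - C x) * (X - C y)) := by
  have ha : 0 < d + 1 - x := by linarith
  obtain ⟨t, ht⟩ : ∃ t, t = x + y - d := ⟨_, rfl⟩
  have he : 0 ≤ (t * (d + 1) - (1 + y) * x) / 4 := by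
    have : 0 ≤ t * (d + 1) := mul_nonneg (by linarith) (by linarith)
    nlinarith
  obtain ⟨e, he0, he2⟩ : ∃ e : ℝ, 0 ≤ e ∧ 4 * e ^ 2 = t * (d + 1) - (1 + y) * x :=
    ⟨_, Real.sqrt_nonneg _, by rw [Real.sq_sqrt he]; ring⟩
  have hN : 0 < 4 * e ^ 2 + (d + 1 - x) ^ 2 := by positivity
  obtain ⟨k, hk0, hk2⟩ : ∃ k : ℝ, 0 ≤ k ∧ 2 * k ^ 2 * (4 * e ^ 2 + (d + 1 - x) ^ 2) = -y := by
    refine ⟨√(-y / (2 * (4 * e ^ 2 + (d + 1 - x) ^ 2))), Real.sqrt_nonneg _, ?_⟩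
    rw [Real.sq_sqrt (div_nonneg (by linarith) (by positivity))]
    field_simp
  refine ⟨_, reflMatrix_mem (p := 2 * e * k) (q := e) (r := e)
    (s := d + 1) (t := t) (u := (d + 1 - x) * k) (by positivity) he0 he0 (by linarith)
    (by linarith) (by positivity), charpoly_reflMatrix_eq ?_ ?_ ?_ ?_ ?_⟩
  · rw [ht]; ring
  · rw [ht]; ring
  · rw [ht]; ring
  · subst ht
    linear_combination he2 + hk2
  · subst ht
    linear_combination x * hk2 - 2 * (d + 1 - x) * k ^ 2 * he2

/-- The trace condition is demanded only for `0 < y`; the other two constructions do without it. -/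
theorem exists_isNormalizedSpectrum {d x y : ℝ} (hd : -1 < d) (hd0 : d ≤ 0)
    (hyx : y ≤ x) (hzy : d - x - y ≤ y) (hwz : -d - 1 ≤ d - x - y) (hx : x ≤ d + 1)
    (hs : 0 < y → 0 ≤ thirdSymm d x y) :
    ∃ A ∈ TraceZeroSymmNonneg, IsNormalizedSpectrum A ![1, x, y, d - x - y, -d - 1] := by
  have key : ∃ A ∈ TraceZeroSymmNonneg, A.charpoly =
      (X - C 1) * (X - C x) * (X - C y) * (X - C (d - x - y)) * (X - C (-d - 1)) := by
    rcases lt_or_ge 0 y with hy | hy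
    · obtain ⟨A, hA, e⟩ := exists_charpoly_of_pos hd0 hyx hwz hy (hs hy)
      exact ⟨A, hA, by rw [e]; ring⟩
    · rcases le_total 0 x with hx0 | hx0
      · obtain ⟨A, hA, e⟩ := exists_charpoly_of_nonneg_of_nonpos hd hd0 hzy hwz hx hx0 hy
        exact ⟨A, hA, by rw [e]; ring⟩
      · obtain ⟨A, hA, e⟩ := exists_charpoly_of_nonpos hd hd0 hyx hzy hwz hx0
        exact ⟨A, hA, by rw [e]; ring⟩
  obtain ⟨A, hA, e⟩ := key
  refine ⟨A, hA, ?_, rfl, ?_, ?_⟩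
  · rw [e, Fin.prod_univ_five]; rfl
  · rw [Fin.antitone_iff_succ_le]
    intro i
    fin_cases i <;> simp <;> linarith
  · simp [hd0]

/-! ### Necessity: eigenvectors, Rayleigh quotients and the trace of the cube. -/

open Matrix

/-- Compare the eigenvalue equation at a maximal coordinate `v i`: at most one other coordinate `v j
≤ v i` contributes positively, so `b * v i ≤ A i j * v i`. -/
theorem exists_le_apply_of_mulVec_eq {n : Type*} [Fintype n] [DecidableEq n]
    {A : Matrix n n ℝ} (hA : ∀ i j, 0 ≤ A i j) (hdiag : ∀ i, A i i = 0) {v : n → ℝ} {b : ℝ}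
    (hv : A *ᵥ v = b • v) (hne : (Finset.univ.filter fun i => 0 < v i).Nonempty)
    (hb : 0 < b) (hcard : (Finset.univ.filter fun i => 0 < v i).card ≤ 2) :
    ∃ i j, i ≠ j ∧ b ≤ A i j := by
  obtain ⟨i, hi, hmax⟩ := Finset.exists_max_image _ v hne
  set S := Finset.univ.filter fun i => 0 < v i with hS
  have hvi : 0 < v i := (Finset.mem_filter.mp hi).2
  have h₁ : b * v i ≤ ∑ j ∈ S.erase i, A i j * v j := by
    have h₂ : b * v i = ∑ j, A i j * v j := (congrFun hv i).symm
    rw [h₂, ← Finset.sum_filter_add_sum_filter_not _ (fun j => 0 < v j), ← hS,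
      ← Finset.add_sum_erase S _ hi, hdiag, zero_mul, zero_add]
    have : ∑ j with ¬ 0 < v j, A i j * v j ≤ 0 := Finset.sum_nonpos fun j hj =>
      mul_nonpos_of_nonneg_of_nonpos (hA i j) (not_lt.mp (Finset.mem_filter.mp hj).2)
    linarith
  have hc : (S.erase i).card ≤ 1 := by
    rw [Finset.card_erase_of_mem hi]; omega
  have : Nonempty n := ⟨i⟩
  rcases Finset.card_le_one_iff_subset_singleton.mp hc with ⟨j, hj⟩
  rcases Finset.subset_singleton_iff.mp hj with h | h
  · rw [h, Finset.sum_empty] at h₁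
    exact absurd h₁ (not_le.mpr (mul_pos hb hvi))
  · rw [h, Finset.sum_singleton] at h₁
    have hjS : j ∈ S.erase i := h ▸ Finset.mem_singleton_self j
    refine ⟨i, j, (Finset.ne_of_mem_erase hjS).symm, ?_⟩
    have := mul_le_mul_of_nonneg_left (hmax j (Finset.mem_of_mem_erase hjS)) (hA i j)
    exact le_of_mul_le_mul_right (h₁.trans this) hvi

/-- Of an eigenvector in dimension five, unless it has constant sign and at least three nonzero
coordinates, the positive or the negative part has at most two coordinates. -/
theorem exists_le_apply_or_sign {A : Matrix (Fin 5) (Fin 5) ℝ} (hA : ∀ i j, 0 ≤ A i j)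
    (hdiag : ∀ i, A i i = 0) {v : Fin 5 → ℝ} {b : ℝ} (hv : A *ᵥ v = b • v) (hb : 0 < b)
    (hv0 : v ≠ 0) :
    (∃ i j, i ≠ j ∧ b ≤ A i j) ∨
      ∃ c : ℝ, c ≠ 0 ∧ (∀ i, 0 ≤ c * v i) ∧
        3 ≤ (Finset.univ.filter fun i => 0 < c * v i).card := by
  by_contra! hcon
  obtain ⟨hno, hc⟩ := hcon
  have key : ∀ c : ℝ, (Finset.univ.filter fun i => 0 < c * v i).Nonempty →
      3 ≤ (Finset.univ.filter fun i => 0 < c * v i).card := by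
    intro c hne
    by_contra! hlt
    obtain ⟨i, j, hij, h⟩ := exists_le_apply_of_mulVec_eq hA hdiag (v := c • v) (b := b)
      (by rw [mulVec_smul, hv, smul_comm]) hne hb (by exact Nat.le_of_lt_succ hlt)
    exact (hno i j hij).not_ge h
  have hne : ∀ c : ℝ, c ≠ 0 → (Finset.univ.filter fun i => 0 < c * v i).Nonempty := by
    intro c hc0
    by_contra hemp
    have hle : ∀ i, 0 ≤ (-c) * v i := by
      intro i
      by_contra! hi
      exact hemp ⟨i, by simpa using hi⟩
    obtain ⟨i, hi⟩ := Function.ne_iff.mp hv0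
    have h3 := key (-c) ⟨i, by
      simpa using lt_of_le_of_ne (hle i) (mul_ne_zero (neg_ne_zero.mpr hc0) hi).symm⟩
    exact (hc (-c) (neg_ne_zero.mpr hc0) hle).not_ge h3
  have h1 := key 1 (hne 1 one_ne_zero)
  have h2 := key (-1) (hne (-1) (by norm_num))
  have hdisj : Disjoint (Finset.univ.filter fun i => 0 < 1 * v i)
      (Finset.univ.filter fun i => 0 < -1 * v i) := by
    rw [Finset.disjoint_filter]
    intro i _ h h'
    linarith
  have := Finset.card_le_univ ((Finset.univ.filter fun i => 0 < 1 * v i) ∪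
    (Finset.univ.filter fun i => 0 < -1 * v i))
  rw [Finset.card_union_of_disjoint hdisj, Fintype.card_fin] at this
  omega

/-- Two vectors of constant sign, each with at least three nonzero coordinates out of five, share
one and cannot be orthogonal. -/
theorem exists_le_apply_of_orthogonal {A : Matrix (Fin 5) (Fin 5) ℝ} (hA : ∀ i j, 0 ≤ A i j)
    (hdiag : ∀ i, A i i = 0) {u v : Fin 5 → ℝ} {a b x : ℝ} (hu : A *ᵥ u = a • u)
    (hv : A *ᵥ v = b • v) (hx : 0 < x) (ha : x ≤ a) (hb : x ≤ b) (hu0 : u ≠ 0) (hv0 : v ≠ 0)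
    (huv : ∑ i, u i * v i = 0) : ∃ i j, i ≠ j ∧ x ≤ A i j := by
  rcases exists_le_apply_or_sign hA hdiag hu (hx.trans_le ha) hu0 with
    ⟨i, j, hij, h⟩ | ⟨c, hc, hcu, hcu3⟩
  · exact ⟨i, j, hij, ha.trans h⟩
  rcases exists_le_apply_or_sign hA hdiag hv (hx.trans_le hb) hv0 with
    ⟨i, j, hij, h⟩ | ⟨e, he, hev, hev3⟩
  · exact ⟨i, j, hij, hb.trans h⟩
  exfalso
  have hsum : ∑ i, (c * u i) * (e * v i) = 0 := by
    rw [← mul_zero (c * e), ← huv, Finset.mul_sum]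
    exact Finset.sum_congr rfl fun i _ => by ring
  have h0 := (Finset.sum_eq_zero_iff_of_nonneg fun i _ => mul_nonneg (hcu i) (hev i)).mp hsum
  have hdisj : Disjoint (Finset.univ.filter fun i => 0 < c * u i)
      (Finset.univ.filter fun i => 0 < e * v i) := by
    rw [Finset.disjoint_filter]
    intro i hi h h'
    exact (mul_pos h h').ne' (h0 i hi)
  have := Finset.card_le_univ ((Finset.univ.filter fun i => 0 < c * u i) ∪
    (Finset.univ.filter fun i => 0 < e * v i))
  rw [Finset.card_union_of_disjoint hdisj, Fintype.card_fin] at this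
  omega

/-- Both `lam` and `eigenvalues₀` are the decreasingly sorted roots; the permutation only undoes the
indexing of `eigenvalues`. -/
theorem exists_equiv_eigenvalues_eq {n : ℕ} {A : Matrix (Fin n) (Fin n) ℝ} (hA : A.IsHermitian)
    {lam : Fin n → ℝ} (hlam : Antitone lam) (h : A.charpoly = ∏ i, (X - C (lam i))) :
    ∃ e : Fin n ≃ Fin n, ∀ i, hA.eigenvalues i = lam (e i) := by
  have hs := hA.sort_roots_charpoly_eq_eigenvalues₀
  have hr : A.charpoly.roots = Multiset.map lam Finset.univ.val := by
    rw [h, Polynomial.roots_prod _ _ (by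
      simp [Finset.prod_ne_zero_iff, Polynomial.X_sub_C_ne_zero])]
    simp
  have hl : (A.charpoly.roots.map RCLike.re).sort (· ≥ ·) = List.ofFn lam := by
    rw [hr]
    simp_rw [Multiset.map_map, Fin.univ_val_map, Function.comp_def, RCLike.re_to_real,
      Multiset.coe_sort]
    apply List.mergeSort_of_pairwise
    simp_rw [decide_eq_true_eq, ← List.sortedGE_iff_pairwise]
    exact hlam.sortedGE_ofFn
  rw [hl] at hs
  have hcast : ∀ i, hA.eigenvalues₀ i = lam (Fin.cast (Fintype.card_fin n) i) := by
    intro i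
    have hi : i.1 < n := by simpa using i.2
    have := List.getElem_of_eq hs (i := i.1) (by simpa using hi)
    simp only [List.getElem_ofFn] at this
    exact this.symm
  exact ⟨(Fintype.equivOfCardEq (Fintype.card_fin _)).symm.trans
    (finCongr (Fintype.card_fin n)), fun i => hcast _⟩

theorem trace_pow_eq_sum_eigenvalues_pow {n : Type*} [Fintype n] [DecidableEq n]
    {A : Matrix n n ℝ} (hA : A.IsHermitian) (k : ℕ) :
    (A ^ k).trace = ∑ i, hA.eigenvalues i ^ k := by
  conv_lhs => rw [hA.spectral_theorem, ← map_pow, Unitary.conjStarAlgAut_apply, trace_mul_comm,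
    ← mul_assoc]
  simp [diagonal_pow, trace_diagonal]

theorem le_dotProduct_mulVec {n : Type*} [Fintype n] [DecidableEq n]
    {A : Matrix n n ℝ} (hA : A.IsHermitian) {w : ℝ} (hw : ∀ i, w ≤ hA.eigenvalues i)
    (v : n → ℝ) : w * (v ⬝ᵥ v) ≤ v ⬝ᵥ A *ᵥ v := by
  have h : (A - w • (1 : Matrix n n ℝ)).PosSemidef := by
    have e : A - w • (1 : Matrix n n ℝ) = (hA.eigenvectorUnitary : Matrix n n ℝ) *
        diagonal (fun i => hA.eigenvalues i - w) * (hA.eigenvectorUnitary : Matrix n n ℝ)ᴴ := by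
      have hd : diagonal (fun i => hA.eigenvalues i - w) =
          diagonal hA.eigenvalues - w • (1 : Matrix n n ℝ) := by
        rw [← diagonal_one, ← diagonal_smul, diagonal_sub]
        simp
      have hU : (hA.eigenvectorUnitary : Matrix n n ℝ) * (hA.eigenvectorUnitary : Matrix n n ℝ)ᴴ
          = 1 := Unitary.coe_mul_star_self _
      have hsp := hA.spectral_theorem
      rw [Unitary.conjStarAlgAut_apply] at hsp
      rw [hd, mul_sub, sub_mul, Matrix.mul_smul, Matrix.smul_mul, Matrix.mul_one, hU]
      exact congrArg (· - w • (1 : Matrix n n ℝ)) hsp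
    rw [e]
    exact (PosSemidef.diagonal fun i => sub_nonneg.mpr (hw i)).mul_mul_conjTranspose_same _
  have := h.dotProduct_mulVec_nonneg v
  rw [sub_mulVec, smul_mulVec, one_mulVec, dotProduct_sub, dotProduct_smul] at this
  simpa using this

theorem IsNormalizedSpectrum.inequalities {d x y : ℝ} (hd : -1 < d)
    {A : Matrix (Fin 5) (Fin 5) ℝ} (hA : A ∈ TraceZeroSymmNonneg)
    (h : IsNormalizedSpectrum A ![1, x, y, d - x - y, -d - 1]) :
    y ≤ x ∧ d - x - y ≤ y ∧ -d - 1 ≤ d - x - y ∧ x ≤ d + 1 ∧ 0 ≤ thirdSymm d x y := by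
  obtain ⟨hsymm, hnn, htr⟩ := hA
  obtain ⟨hchar, -, hanti, -⟩ := h
  have hH : A.IsHermitian := by
    rw [IsHermitian, conjTranspose_eq_transpose_of_trivial]
    exact hsymm
  have hx1 : x ≤ 1 := hanti (show (0 : Fin 5) ≤ 1 by decide)
  have hyx : y ≤ x := hanti (show (1 : Fin 5) ≤ 2 by decide)
  have hzy : d - x - y ≤ y := hanti (show (2 : Fin 5) ≤ 3 by decide)
  have hwz : -d - 1 ≤ d - x - y := hanti (show (3 : Fin 5) ≤ 4 by decide)
  have hdiag : ∀ i, A i i = 0 := fun i =>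
    (Finset.sum_eq_zero_iff_of_nonneg fun i _ => hnn i i).mp htr i (Finset.mem_univ i)
  obtain ⟨e, he⟩ := exists_equiv_eigenvalues_eq hH hanti hchar
  refine ⟨hyx, hzy, hwz, ?_, ?_⟩
  · by_contra! hlt
    have hx0 : 0 < x := by linarith
    have hvec : ∀ k, A *ᵥ ⇑(hH.eigenvectorBasis (e.symm k)) =
        (![1, x, y, d - x - y, -d - 1] k : ℝ) • ⇑(hH.eigenvectorBasis (e.symm k)) := by
      intro k
      rw [hH.mulVec_eigenvectorBasis, he, e.apply_symm_apply]
    have hne : ∀ k, (⇑(hH.eigenvectorBasis k) : Fin 5 → ℝ) ≠ 0 := fun k =>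
      (WithLp.ofLp_eq_zero 2).ne.2 <| hH.eigenvectorBasis.orthonormal.ne_zero k
    have horth := hH.eigenvectorBasis.orthonormal.2
      (e.symm.injective.ne (show (0 : Fin 5) ≠ 1 by decide))
    obtain ⟨i, j, hij, hAij⟩ := exists_le_apply_of_orthogonal hnn hdiag (hvec 0) (hvec 1) hx0
      hx1 le_rfl (hne _) (hne _) (by
        rw [← horth, PiLp.inner_apply]
        exact Finset.sum_congr rfl fun k _ => by simp [mul_comm])
    have hw : ∀ k, -d - 1 ≤ hH.eigenvalues k := by
      intro k
      rw [he]
      exact hanti (Fin.le_last (e k))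
    -- On `e_i - e_j` the quadratic form is `-2 A i j` and the squared norm is `2`, so `-d - 1 ≤ -A
    -- i j ≤ -x`.
    have hq := le_dotProduct_mulVec hH hw (Pi.single i 1 - Pi.single j 1)
    have hji : A j i = A i j := hsymm.apply i j
    simp [sub_dotProduct, dotProduct_sub, mulVec_sub, hdiag, hij, hij.symm, hji] at hq
    linarith
  · have h3 := trace_pow_eq_sum_eigenvalues_pow hH 3
    have hpos : 0 ≤ (A ^ 3).trace := by
      rw [pow_three]
      refine Finset.sum_nonneg fun i _ => ?_
      simp only [diag_apply, mul_apply]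
      exact Finset.sum_nonneg fun j _ => mul_nonneg (hnn _ _)
        (Finset.sum_nonneg fun k _ => mul_nonneg (hnn _ _) (hnn _ _))
    simp_rw [he] at h3
    rw [Equiv.sum_comp e fun k => (![1, x, y, d - x - y, -d - 1] k : ℝ) ^ 3] at h3
    rw [h3] at hpos
    simp [Fin.sum_univ_five] at hpos
    rw [thirdSymm]
    linarith


/-! ### The triangle and the quadrangle as systems of inequalities. -/

theorem mem_segment_of_mem_Icc {m k x₀ x₁ x : ℝ} (h : x ∈ Set.Icc x₀ x₁) :
    (x, m * x + k) ∈ segment ℝ (x₀, m * x₀ + k) (x₁, m * x₁ + k) := by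
  rw [← segment_eq_Icc (h.1.trans h.2)] at h
  obtain ⟨a, b, ha, hb, hab, rfl⟩ := h
  refine ⟨a, b, ha, hb, hab, ?_⟩
  ext
  · simp
  · simp
    linear_combination k * hab

theorem mem_Icc_of_mem_segment {m k x₀ x₁ x y : ℝ} (hx : x₀ ≤ x₁)
    (h : (x, y) ∈ segment ℝ (x₀, m * x₀ + k) (x₁, m * x₁ + k)) :
    x ∈ Set.Icc x₀ x₁ ∧ y = m * x + k := by
  obtain ⟨a, b, ha, hb, hab, h⟩ := h
  simp only [Prod.smul_mk, smul_eq_mul, Prod.mk_add_mk, Prod.mk.injEq] at h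
  obtain ⟨rfl, rfl⟩ := h
  refine ⟨?_, by linear_combination k * hab⟩
  rw [← segment_eq_Icc hx]
  exact ⟨a, b, ha, hb, hab, rfl⟩

theorem mk_mem_segment_vertical {x y y₀ y₁ : ℝ} (h₀ : y₀ ≤ y) (h₁ : y ≤ y₁) :
    (x, y) ∈ segment ℝ (x, y₀) (x, y₁) := by
  have h : y ∈ segment ℝ y₀ y₁ := segment_eq_Icc (h₀.trans h₁) ▸ ⟨h₀, h₁⟩
  obtain ⟨a, b, ha, hb, hab, rfl⟩ := h
  refine ⟨a, b, ha, hb, hab, ?_⟩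
  ext
  · simp [← add_mul, hab]
  · simp

theorem convex_setOf_linear_le {a₁ b₁ c₁ : ℝ} :
    Convex ℝ {p : ℝ × ℝ | a₁ * p.1 + b₁ * p.2 ≤ c₁} :=
  convex_halfSpace_le ⟨fun p q => by simp; ring, fun c p => by simp; ring⟩ _

/-- The sides are `x = y`, `y = z` and `z = w`. Conversely, a point lies on a vertical segment
between two boundary points, the upper edge changing at `B`. -/
theorem mem_triangleABC_iff {d x y : ℝ} (hd : -3 / 4 ≤ d) :
    (x, y) ∈ triangleABC d ↔ y ≤ x ∧ d - x - y ≤ y ∧ -d - 1 ≤ d - x - y := by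
  constructor
  · intro h
    have h₁ : triangleABC d ⊆ {p : ℝ × ℝ | (-1) * p.1 + 1 * p.2 ≤ 0} :=
      convexHull_min (by
        rintro p (rfl | rfl | rfl) <;> simp [ptA, ptB, ptC] <;> linarith) convex_setOf_linear_le
    have h₂ : triangleABC d ⊆ {p : ℝ × ℝ | (-1) * p.1 + (-2) * p.2 ≤ -d} :=
      convexHull_min (by
        rintro p (rfl | rfl | rfl) <;> simp [ptA, ptB, ptC] <;> linarith) convex_setOf_linear_le
    have h₃ : triangleABC d ⊆ {p : ℝ × ℝ | 1 * p.1 + 1 * p.2 ≤ 2 * d + 1} :=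
      convexHull_min (by
        rintro p (rfl | rfl | rfl) <;> simp [ptA, ptB, ptC] <;> linarith) convex_setOf_linear_le
    have := h₁ h
    have := h₂ h
    have := h₃ h
    simp only [Set.mem_ofPred_eq] at *
    refine ⟨?_, ?_, ?_⟩ <;> linarith
  · rintro ⟨h₁, h₂, h₃⟩
    have hA : ptA d ∈ triangleABC d := subset_convexHull _ _ (by simp)
    have hB : ptB d ∈ triangleABC d := subset_convexHull _ _ (by simp)
    have hC : ptC d ∈ triangleABC d := subset_convexHull _ _ (by simp)
    have hc : Convex ℝ (triangleABC d) := convex_convexHull _ _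
    have hlow : (x, -(1 / 2) * x + d / 2) ∈ triangleABC d := by
      refine hc.segment_subset hA hC ?_
      convert! mem_segment_of_mem_Icc (m := -(1 / 2)) (k := d / 2) (x₀ := d / 3)
        (x₁ := 3 * d + 2) (x := x) ⟨by linarith, by linarith⟩ using 1
      congr 1 <;> simp [ptA, ptC] <;> ring
    rcases le_total x (d + 1 / 2) with hx | hx
    · have hup : (x, 1 * x + 0) ∈ triangleABC d := by
        refine hc.segment_subset hA hB ?_
        convert! mem_segment_of_mem_Icc (m := 1) (k := 0) (x₀ := d / 3)
          (x₁ := d + 1 / 2) (x := x) ⟨by linarith, by linarith⟩ using 1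
        congr 1 <;> simp [ptA, ptB]
      exact hc.segment_subset hlow hup (mk_mem_segment_vertical (by linarith) (by linarith))
    · have hup : (x, (-1) * x + (2 * d + 1)) ∈ triangleABC d := by
        refine hc.segment_subset hB hC ?_
        convert! mem_segment_of_mem_Icc (m := -1) (k := 2 * d + 1) (x₀ := d + 1 / 2)
          (x₁ := 3 * d + 2) (x := x) ⟨by linarith, by linarith⟩ using 1
        congr 1 <;> simp [ptC, ptB] <;> ring
      exact hc.segment_subset hlow hup (mk_mem_segment_vertical (by linarith) (by linarith))

theorem mem_quadrangleABFG_iff {d x y : ℝ} (hd : -1 / 2 ≤ d) :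
    (x, y) ∈ quadrangleABFG d ↔
      y ≤ x ∧ d - x - y ≤ y ∧ -d - 1 ≤ d - x - y ∧ x ≤ d + 1 := by
  constructor
  · intro h
    have h₁ : quadrangleABFG d ⊆ {p : ℝ × ℝ | (-1) * p.1 + 1 * p.2 ≤ 0} :=
      convexHull_min (by
        rintro p (rfl | rfl | rfl | rfl) <;> simp [ptA, ptB, ptF, ptG] <;> linarith)
        convex_setOf_linear_le
    have h₂ : quadrangleABFG d ⊆ {p : ℝ × ℝ | (-1) * p.1 + (-2) * p.2 ≤ -d} :=
      convexHull_min (by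
        rintro p (rfl | rfl | rfl | rfl) <;> simp [ptA, ptB, ptF, ptG] <;> linarith)
        convex_setOf_linear_le
    have h₃ : quadrangleABFG d ⊆ {p : ℝ × ℝ | 1 * p.1 + 1 * p.2 ≤ 2 * d + 1} :=
      convexHull_min (by
        rintro p (rfl | rfl | rfl | rfl) <;> simp [ptA, ptB, ptF, ptG] <;> linarith)
        convex_setOf_linear_le
    have h₄ : quadrangleABFG d ⊆ {p : ℝ × ℝ | 1 * p.1 + 0 * p.2 ≤ d + 1} :=
      convexHull_min (by
        rintro p (rfl | rfl | rfl | rfl) <;> simp [ptA, ptB, ptF, ptG] <;> linarith)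
        convex_setOf_linear_le
    have := h₁ h
    have := h₂ h
    have := h₃ h
    have := h₄ h
    simp only [Set.mem_ofPred_eq] at *
    refine ⟨?_, ?_, ?_, ?_⟩ <;> linarith
  · rintro ⟨h₁, h₂, h₃, h₄⟩
    have hA : ptA d ∈ quadrangleABFG d := subset_convexHull _ _ (by simp)
    have hB : ptB d ∈ quadrangleABFG d := subset_convexHull _ _ (by simp)
    have hF : ptF d ∈ quadrangleABFG d := subset_convexHull _ _ (by simp)
    have hG : ptG d ∈ quadrangleABFG d := subset_convexHull _ _ (by simp)
    have hc : Convex ℝ (quadrangleABFG d) := convex_convexHull _ _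
    have hlow : (x, -(1 / 2) * x + d / 2) ∈ quadrangleABFG d := by
      refine hc.segment_subset hA hG ?_
      convert! mem_segment_of_mem_Icc (m := -(1 / 2)) (k := d / 2) (x₀ := d / 3)
        (x₁ := d + 1) (x := x) ⟨by linarith, by linarith⟩ using 1
      congr 1 <;> simp [ptA, ptG] <;> ring
    rcases le_total x (d + 1 / 2) with hx | hx
    · have hup : (x, 1 * x + 0) ∈ quadrangleABFG d := by
        refine hc.segment_subset hA hB ?_
        convert! mem_segment_of_mem_Icc (m := 1) (k := 0) (x₀ := d / 3)
          (x₁ := d + 1 / 2) (x := x) ⟨by linarith, by linarith⟩ using 1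
        congr 1 <;> simp [ptA, ptB]
      exact hc.segment_subset hlow hup (mk_mem_segment_vertical (by linarith) (by linarith))
    · have hup : (x, (-1) * x + (2 * d + 1)) ∈ quadrangleABFG d := by
        refine hc.segment_subset hB hF ?_
        convert! mem_segment_of_mem_Icc (m := -1) (k := 2 * d + 1) (x₀ := d + 1 / 2)
          (x₁ := d + 1) (x := x) ⟨by linarith, by linarith⟩ using 1
        congr 1 <;> simp [ptF, ptB] <;> ring
      exact hc.segment_subset hlow hup (mk_mem_segment_vertical (by linarith) (by linarith))


/-! ### The cubic curve and the region `P`. -/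

/-- Cardano's formula for the point where `thirdSymm` vanishes on the diagonal: `f d = (2d - σ -
τ)/3` with `στ = d²`, where `4σ³` and `4τ³` are `r d` and its conjugate. -/
theorem f_cubic {d : ℝ} (hd : -1 ≤ d) : 2 * f d * (f d - d) ^ 2 = -d * (d + 1) := by
  by_cases h0 : d = 0
  · simp [f, h0]
  set R := √3 * √(d ^ 2 * (d + 1) * (8 * d ^ 2 + 27 * d + 27)) with hR
  have hR2 : R ^ 2 = 3 * (d ^ 2 * (d + 1) * (8 * d ^ 2 + 27 * d + 27)) := by
    rw [hR, mul_pow, Real.sq_sqrt (by norm_num), Real.sq_sqrt]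
    exact mul_nonneg (mul_nonneg (sq_nonneg d) (by linarith))
      (by nlinarith [sq_nonneg (d + 27 / 16)])
  have hr : r d = 4 * d ^ 3 + 27 * d ^ 2 + 27 * d + 3 * R := by
    rw [r, hR]; ring
  have hmul : r d * (4 * d ^ 3 + 27 * d ^ 2 + 27 * d - 3 * R) = 16 * d ^ 6 := by
    rw [hr]; linear_combination -9 * hR2
  have hr0 : r d ≠ 0 := by
    intro h
    rw [h, zero_mul] at hmul
    exact h0 (by simpa using hmul.symm)
  have hk := cbrt_pow_three 4
  have hρ := cbrt_pow_three (r d)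
  have hk0 : cbrt 4 ≠ 0 := by
    intro h; rw [h] at hk; norm_num at hk
  have hρ0 : cbrt (r d) ≠ 0 := by
    intro h; rw [h] at hρ; exact hr0 (by simpa using hρ.symm)
  set σ := cbrt (r d) / cbrt 4 with hσ
  have hσ0 : σ ≠ 0 := div_ne_zero hρ0 hk0
  have hσ3 : 4 * σ ^ 3 = r d := by
    rw [hσ, div_pow, hk, hρ]; ring
  have hf : f d = (2 * d - (σ + d ^ 2 / σ)) / 3 := by
    rw [f, if_neg h0, hσ]
    field_simp
    ring
  have hsum : σ ^ 3 + (d ^ 2 / σ) ^ 3 = (4 * d ^ 3 + 27 * d ^ 2 + 27 * d) / 2 := by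
    have h16 : (d ^ 2 / σ) ^ 3 * (4 * σ ^ 3) = 4 * d ^ 6 := by
      field_simp
    have : (d ^ 2 / σ) ^ 3 = (4 * d ^ 3 + 27 * d ^ 2 + 27 * d - 3 * R) / 4 := by
      refine mul_right_cancel₀ hr0 ?_
      rw [← hσ3, h16, hσ3]
      linarith
    rw [this]
    linarith
  have hprod : σ * (d ^ 2 / σ) = d ^ 2 := by field_simp
  rw [hf]
  generalize d ^ 2 / σ = τ at *
  linear_combination -2 / 27 * hsum - 2 / 9 * (σ + τ) * hprod

theorem f_nonneg {d : ℝ} (hd : -1 < d) (hd0 : d ≤ 0) : 0 ≤ f d := by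
  by_contra! h
  have h₁ := f_cubic hd.le
  rcases hd0.eq_or_lt with rfl | hlt
  · simp [f] at h
  · have := mul_nonpos_of_nonpos_of_nonneg h.le (sq_nonneg (f d - d))
    have := mul_pos (neg_pos.mpr hlt) (show 0 < d + 1 by linarith)
    linarith

theorem f_le {d : ℝ} (hd : -1 / 2 < d) (hq : 0 ≤ 4 * d ^ 2 + 6 * d + 1) :
    f d ≤ d + 1 / 2 := by
  by_contra! h
  have h₁ := f_cubic (d := d) (by linarith)
  have h₂ : (1 / 2) ^ 2 < (f d - d) ^ 2 := by
    exact pow_lt_pow_left₀ (by linarith) (by norm_num) two_ne_zero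
  have : (d + 1 / 2) * (1 / 2) ^ 2 < f d * (f d - d) ^ 2 :=
    mul_lt_mul'' h h₂ (by linarith) (by norm_num)
  nlinarith

/-- In `y` this is a concave parabola with axis `y = z`, hence decreasing where `z ≤ y`. -/
theorem thirdSymm_le_thirdSymm {d x y y' : ℝ} (hx : d ≤ x) (hy : d - x - y ≤ y) (hyy : y ≤ y') :
    thirdSymm d x y' ≤ thirdSymm d x y := by
  have : 0 ≤ (x - d) * (y' - y) * (y' + y + (x - d)) :=
    mul_nonneg (mul_nonneg (by linarith) (by linarith)) (by linarith)
  unfold thirdSymm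
  linarith

theorem thirdSymm_lt_thirdSymm {d x y y' : ℝ} (hx : d < x) (hy : d - x - y ≤ y) (hyy : y < y') :
    thirdSymm d x y' < thirdSymm d x y := by
  have : 0 < (x - d) * (y' - y) * (y' + y + (x - d)) :=
    mul_pos (mul_pos (by linarith) (by linarith)) (by linarith)
  unfold thirdSymm
  linarith

theorem thirdSymm_self (d x : ℝ) : thirdSymm d x x = -2 * x * (x - d) ^ 2 - d * (d + 1) := by
  unfold thirdSymm; ring

theorem thirdSymm_self_nonneg {d x : ℝ} (hd : -1 ≤ d) (hx0 : 0 ≤ x) (hdx : d ≤ x)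
    (hx : x ≤ f d) : 0 ≤ thirdSymm d x x := by
  have h := f_cubic hd
  have hf := hx0.trans hx
  have : x * (x - d) ^ 2 ≤ f d * (f d - d) ^ 2 := by gcongr
  rw [thirdSymm_self]
  linarith

theorem thirdSymm_self_nonpos {d x : ℝ} (hd : -1 < d) (hd0 : d ≤ 0)
    (hx : f d ≤ x) : thirdSymm d x x ≤ 0 := by
  have h := f_cubic hd.le
  have hf := f_nonneg hd hd0
  have hx0 := hf.trans hx
  have hfd : 0 ≤ f d - d := by linarith
  have : f d * (f d - d) ^ 2 ≤ x * (x - d) ^ 2 := by gcongr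
  rw [thirdSymm_self]
  linarith

theorem g_nonneg (d : ℝ) : 0 ≤ g d := Real.sqrt_nonneg _

theorem g_sq {d : ℝ} (hd : -1 / 2 < d) (hq : 0 ≤ 4 * d ^ 2 + 6 * d + 1) :
    (2 * d + 1) * g d ^ 2 = d ^ 2 + 3 / 2 * d + 1 / 4 := by
  have h5 : √5 ^ 2 = 5 := Real.sq_sqrt (by norm_num)
  have e : (d - (-3 / 4 + √5 / 4)) * (d - (-3 / 4 - √5 / 4)) = d ^ 2 + 3 / 2 * d + 1 / 4 := by
    linear_combination -1 / 16 * h5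
  have hd' : 0 < 2 * d + 1 := by linarith
  rw [g, e, Real.sq_sqrt (div_nonneg (by linarith) hd'.le), mul_div_cancel₀ _ hd'.ne']

theorem g_le {d : ℝ} (hd : -1 / 2 < d) (hd0 : d ≤ 0) (hq : 0 ≤ 4 * d ^ 2 + 6 * d + 1) :
    g d ≤ 1 / 2 := by
  have h := g_sq hd hq
  have : g d ^ 2 ≤ (1 / 2) ^ 2 := by
    refine le_of_mul_le_mul_left (a := 2 * d + 1) ?_ (by linarith)
    rw [h]
    nlinarith
  exact le_of_sq_le_sq this (by norm_num)

/-- On the line `z = w` the sign changes at `d + 1/2 ± g d`; the right-hand zero is `I`. -/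
theorem thirdSymm_edge {d x : ℝ} (hd : -1 / 2 < d) (hq : 0 ≤ 4 * d ^ 2 + 6 * d + 1) :
    thirdSymm d x (2 * d + 1 - x) = (2 * d + 1) * ((x - (d + 1 / 2)) ^ 2 - g d ^ 2) := by
  unfold thirdSymm
  linear_combination g_sq hd hq

/-- `h d x` is the larger root of `thirdSymm d x` as a quadratic in `y`; completing the square gives
`e`. -/
theorem le_h_iff {d x y : ℝ} (hd : -1 ≤ d) (hd0 : d ≤ 0) (hx : d < x) (hy : d - x - y ≤ y) :
    y ≤ h d x ↔ 0 ≤ thirdSymm d x y := by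
  have hx' : 0 < x - d := sub_pos.mpr hx
  set E := (x ^ 3 + d * x ^ 2 - d ^ 2 * x - 4 * d - 4 * d ^ 2 - d ^ 3) / (x - d) with hE
  have hE' : (x - d) * E = x ^ 3 + d * x ^ 2 - d ^ 2 * x - 4 * d - 4 * d ^ 2 - d ^ 3 :=
    mul_div_cancel₀ _ hx'.ne'
  have hE0 : 0 ≤ E := by
    refine nonneg_of_mul_nonneg_right (b := E) ?_ hx'
    have := mul_nonneg (neg_nonneg.mpr hd0) (show 0 ≤ d + 1 by linarith)
    have := mul_nonneg (sq_nonneg (x + d)) hx'.le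
    rw [hE']
    linarith
  have e : 4 * thirdSymm d x y = (x - d) * (E - (2 * y + (x - d)) ^ 2) := by
    rw [thirdSymm]; linear_combination -hE'
  have h₁ : y ≤ h d x ↔ 2 * y + (x - d) ≤ √E := by
    rw [h, ← hE]
    constructor <;> intro h <;> linarith
  rw [h₁, Real.le_sqrt (by linarith) hE0, ← sub_nonneg,
    ← mul_nonneg_iff_of_pos_left hx', ← e]
  constructor <;> intro h <;> linarith

theorem thirdSymm_nonneg_of_quadratic_nonpos {d x y : ℝ} (hd : -1 ≤ d) (hd0 : d ≤ 0)
    (hq : 4 * d ^ 2 + 6 * d + 1 ≤ 0) (hy : 0 ≤ y) (hyx : y ≤ x)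
    (hwz : -d - 1 ≤ d - x - y) : 0 ≤ thirdSymm d x y := by
  obtain ⟨m, hm⟩ : ∃ m, m = x + y := ⟨_, rfl⟩
  have e : thirdSymm d x y = (d + 1) * (m - d) * (1 + m) - (1 + m + x * y) * m := by
    rw [hm, thirdSymm]; ring
  -- For fixed sum `m` the worst case is the diagonal point `x = y = m/2`.
  have hxy : x * y ≤ m ^ 2 / 4 := by rw [hm]; nlinarith [sq_nonneg (x - y)]
  have hm0 : 0 ≤ m := by linarith
  have h₁ : (1 + m + x * y) * m ≤ (1 + m + m ^ 2 / 4) * m := by gcongr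
  have h₂ : 0 ≤ (d + 1) * (m - d) * (1 + m) - (1 + m + m ^ 2 / 4) * m := by
    rcases hm0.eq_or_lt with rfl | hmpos
    · nlinarith
    · refine nonneg_of_mul_nonneg_right ?_ (show 0 < 2 * d + 1 by linarith)
      have k₁ : 0 ≤ m * (-(4 * d ^ 2 + 6 * d + 1)) := by nlinarith
      have k₂ : 0 ≤ (2 * d + 1 - m) * (-d * (d + 1)) :=
        mul_nonneg (by linarith) (by nlinarith)
      have k₃ : 0 ≤ (2 * d + 1) * m * (2 * d + 1 - m) * (m + 1 + 2 * d - 4 * d) :=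
        mul_nonneg (mul_nonneg (mul_nonneg (by linarith) hm0) (by linarith)) (by linarith)
      nlinarith
  linarith

theorem quadratic_nonneg_of_le {d : ℝ} (hd : -3 / 4 + √5 / 4 ≤ d) :
    -1 / 2 < d ∧ 0 ≤ 4 * d ^ 2 + 6 * d + 1 := by
  have h5 : √5 ^ 2 = 5 := Real.sq_sqrt (by norm_num)
  have : 1 < √5 := Real.lt_sqrt_of_sq_lt (by norm_num)
  exact ⟨by linarith, by nlinarith⟩

theorem quadratic_nonpos_of_le {d : ℝ} (hd : -1 / 2 ≤ d) (hd' : d ≤ -3 / 4 + √5 / 4) :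
    d ≤ 0 ∧ 4 * d ^ 2 + 6 * d + 1 ≤ 0 := by
  have h5 : √5 ^ 2 = 5 := Real.sq_sqrt (by norm_num)
  have : √5 < 3 := (Real.sqrt_lt' (by norm_num)).mpr (by norm_num)
  exact ⟨by linarith, by nlinarith⟩

theorem ptA_eq (d : ℝ) : ptA d = (d / 3, 1 * (d / 3) + 0) := by simp [ptA]

theorem ptH_eq (d : ℝ) : ptH d = (f d, 1 * f d + 0) := by simp [ptH]

theorem ptA_eq' (d : ℝ) : ptA d = (d / 3, -(1 / 2) * (d / 3) + d / 2) := by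
  simp only [ptA]; congr 1; ring

theorem ptG_eq (d : ℝ) : ptG d = (d + 1, -(1 / 2) * (d + 1) + d / 2) := by
  simp only [ptG]; congr 1; ring

theorem ptI_eq (d : ℝ) :
    ptI d = (d + 1 / 2 + g d, (-1) * (d + 1 / 2 + g d) + (2 * d + 1)) := by
  simp only [ptI]; congr 1; ring

theorem ptF_eq (d : ℝ) : ptF d = (d + 1, (-1) * (d + 1) + (2 * d + 1)) := by
  simp only [ptF]; congr 1; ring

theorem mem_γ_image_iff {d x y : ℝ} (hfg : f d ≤ d + 1 / 2 + g d) :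
    (x, y) ∈ γ d '' Set.Icc 0 1 ↔ x ∈ Set.Icc (f d) (d + 1 / 2 + g d) ∧ y = h d x := by
  rw [← segment_eq_Icc hfg, segment_eq_image]
  constructor
  · rintro ⟨t, ht, e⟩
    simp only [γ, Prod.mk.injEq] at e
    obtain ⟨rfl, rfl⟩ := e
    exact ⟨⟨t, ht, rfl⟩, rfl⟩
  · rintro ⟨⟨t, ht, rfl⟩, rfl⟩
    exact ⟨t, ht, rfl⟩

/-- Among the upper bounds for `y`, the diagonal binds left of `H`, the cubic curve between `H` and
`I`, and the line `z = w` right of `I`. -/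
theorem mem_P_iff {d x y : ℝ} (hd : -1 / 2 < d) (hd0 : d ≤ 0)
    (hq : 0 ≤ 4 * d ^ 2 + 6 * d + 1) :
    (x, y) ∈ P d ↔ y ≤ x ∧ d - x - y ≤ y ∧ -d - 1 ≤ d - x - y ∧ x ≤ d + 1 ∧
      0 ≤ thirdSymm d x y := by
  have hd1 : -1 < d := by linarith
  have hf0 := f_nonneg hd1 hd0
  have hf1 := f_le hd hq
  have hg0 := g_nonneg d
  have hg1 := g_le hd hd0 hq
  have hfg : f d ≤ d + 1 / 2 + g d := by linarith
  unfold P upperBoundary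
  simp only [Set.mem_ofPred_eq, Set.mem_union, mem_γ_image_iff hfg]
  constructor
  · rintro ⟨y₀, y₁, h₀, h₁, hy₀, hy₁⟩
    rw [ptA_eq', ptG_eq] at h₀
    obtain ⟨⟨hx₀, hx₁⟩, rfl⟩ := mem_Icc_of_mem_segment (by linarith) h₀
    have hz : d - x - y ≤ y := by linarith
    rcases h₁ with (h₁ | ⟨⟨hfx, hxg⟩, rfl⟩) | h₁
    · rw [ptA_eq, ptH_eq] at h₁
      obtain ⟨⟨-, hxf⟩, rfl⟩ := mem_Icc_of_mem_segment (by linarith) h₁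
      refine ⟨by linarith, hz, by linarith, hx₁, ?_⟩
      have hdx : d ≤ x := by linarith
      rcases le_total 0 x with hx | hx
      · exact (thirdSymm_self_nonneg hd1.le hx hdx hxf).trans
          (thirdSymm_le_thirdSymm hdx hz (by linarith))
      · refine le_trans ?_ (thirdSymm_le_thirdSymm hdx hz (y' := x) (by linarith))
        rw [thirdSymm_self]
        nlinarith [mul_nonneg (neg_nonneg.mpr hx) (sq_nonneg (x - d)),
          mul_nonneg (neg_nonneg.mpr hd0) (show 0 ≤ d + 1 by linarith)]
    · rcases (show d ≤ x by linarith).eq_or_lt with rfl | hdx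
      -- The point `t = d = 0`, where the quotient in `h` is `0 / 0 = 0`.
      · have h0 : d = 0 := by linarith
        subst h0
        simp [h] at hy₁
        have : y = 0 := by linarith
        subst this
        norm_num [thirdSymm]
      · have hs := (le_h_iff hd1.le hd0 hdx hz).mp hy₁
        refine ⟨?_, hz, ?_, hx₁, hs⟩
        · by_contra! hlt
          have := thirdSymm_lt_thirdSymm hdx (y := x) (by linarith) hlt
          have := thirdSymm_self_nonpos hd1 hd0 hfx
          linarith
        · by_contra! hlt
          -- A point above the line `z = w` would make `thirdSymm` positive on that line at abscissa
          -- `x`, but it is nonpositive between its two zeros.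
          have hx2 : d + 1 / 2 - g d ≤ x := by
            by_contra! hx2
            have hyx : x < y := by linarith
            have := thirdSymm_lt_thirdSymm hdx (y := x) (by linarith) hyx
            have := thirdSymm_self_nonpos hd1 hd0 hfx
            linarith
          have := thirdSymm_lt_thirdSymm hdx (y := 2 * d + 1 - x) (y' := y) (by linarith)
            (by linarith)
          rw [thirdSymm_edge hd hq] at this
          have : (x - (d + 1 / 2)) ^ 2 ≤ g d ^ 2 :=
            sq_le_sq' (by linarith) (by linarith)
          nlinarith
    · rw [ptI_eq, ptF_eq] at h₁
      obtain ⟨⟨hxg, -⟩, rfl⟩ := mem_Icc_of_mem_segment (by linarith) h₁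
      refine ⟨by linarith, hz, by linarith, hx₁, ?_⟩
      refine le_trans ?_ (thirdSymm_le_thirdSymm (y' := 2 * d + 1 - x) (by linarith) hz
        (by linarith))
      rw [thirdSymm_edge hd hq]
      refine mul_nonneg (by linarith) (sub_nonneg.mpr ?_)
      exact pow_le_pow_left₀ hg0 (by linarith) 2
  · rintro ⟨hyx, hz, hwz, hx, hs⟩
    have hlow : (x, -(1 / 2) * x + d / 2) ∈ segment ℝ (ptA d) (ptG d) := by
      rw [ptA_eq', ptG_eq]
      exact mem_segment_of_mem_Icc ⟨by linarith, hx⟩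
    rcases le_or_gt x (f d) with hxf | hxf
    · refine ⟨_, 1 * x + 0, hlow, .inl (.inl ?_), by linarith, by linarith⟩
      rw [ptA_eq, ptH_eq]
      exact mem_segment_of_mem_Icc ⟨by linarith, hxf⟩
    · rcases le_total x (d + 1 / 2 + g d) with hxg | hxg
      · exact ⟨_, h d x, hlow, .inl (.inr ⟨⟨hxf.le, hxg⟩, rfl⟩), by linarith,
          (le_h_iff hd1.le hd0 (by linarith) hz).mpr hs⟩
      · refine ⟨_, (-1) * x + (2 * d + 1), hlow, .inr ?_, by linarith, by linarith⟩
        rw [ptI_eq, ptF_eq]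
        exact mem_segment_of_mem_Icc ⟨hxg, hx⟩

/-! ### The criterion and the three cases. -/

theorem exists_isNormalizedSpectrum_iff {d x y : ℝ} (hd : -1 < d) (hd0 : d ≤ 0) :
    (∃ A ∈ TraceZeroSymmNonneg, IsNormalizedSpectrum A ![1, x, y, d - x - y, -d - 1]) ↔
      y ≤ x ∧ d - x - y ≤ y ∧ -d - 1 ≤ d - x - y ∧ x ≤ d + 1 ∧ 0 ≤ thirdSymm d x y := by
  constructor
  · rintro ⟨A, hA, h⟩
    exact h.inequalities hd hA
  · rintro ⟨h₁, h₂, h₃, h₄, h₅⟩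
    exact exists_isNormalizedSpectrum hd hd0 h₁ h₂ h₃ h₄ fun _ => h₅

end SNIEP

theorem theorem2 (d x y : ℝ) :
    (d ∈ Set.Icc (-3 / 4 : ℝ) (-1 / 2) →
      ((∃ A ∈ SNIEP.TraceZeroSymmNonneg,
          SNIEP.IsNormalizedSpectrum A ![1, x, y, d - x - y, -d - 1]) ↔
        (x, y) ∈ SNIEP.triangleABC d)) ∧
    (d ∈ Set.Icc (-1 / 2 : ℝ) (-3 / 4 + √5 / 4) →
      ((∃ A ∈ SNIEP.TraceZeroSymmNonneg,
          SNIEP.IsNormalizedSpectrum A ![1, x, y, d - x - y, -d - 1]) ↔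
        (x, y) ∈ SNIEP.quadrangleABFG d)) ∧
    (d ∈ Set.Icc (-3 / 4 + √5 / 4 : ℝ) 0 →
      ((∃ A ∈ SNIEP.TraceZeroSymmNonneg,
          SNIEP.IsNormalizedSpectrum A ![1, x, y, d - x - y, -d - 1]) ↔
        (x, y) ∈ SNIEP.P d)) := by
  refine ⟨?_, ?_, ?_⟩
  · rintro ⟨hd, hd'⟩
    rw [SNIEP.mem_triangleABC_iff hd]
    constructor
    · rintro ⟨A, hA, h⟩
      obtain ⟨h₁, h₂, h₃, -, -⟩ := h.inequalities (by linarith) hA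
      exact ⟨h₁, h₂, h₃⟩
    · rintro ⟨h₁, h₂, h₃⟩
      -- For `d ≤ -1/2` the ordering gives `x ≤ 3d + 2 ≤ d + 1` and `y ≤ d + 1/2 ≤ 0`, so the other
      -- two conditions are void.
      exact SNIEP.exists_isNormalizedSpectrum (by linarith) (by linarith) h₁ h₂ h₃ (by linarith)
        fun hy => by linarith
  · rintro ⟨hd, hd'⟩
    obtain ⟨hd0, hq⟩ := SNIEP.quadratic_nonpos_of_le hd hd'
    rw [SNIEP.mem_quadrangleABFG_iff hd]
    constructor
    · rintro ⟨A, hA, h⟩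
      obtain ⟨h₁, h₂, h₃, h₄, -⟩ := h.inequalities (by linarith) hA
      exact ⟨h₁, h₂, h₃, h₄⟩
    · rintro ⟨h₁, h₂, h₃, h₄⟩
      exact SNIEP.exists_isNormalizedSpectrum (by linarith) hd0 h₁ h₂ h₃ h₄
        fun hy => SNIEP.thirdSymm_nonneg_of_quadratic_nonpos (by linarith) hd0 hq hy.le h₁ h₃
  · rintro ⟨hd, hd0⟩
    obtain ⟨hd1, hq⟩ := SNIEP.quadratic_nonneg_of_le hd
    rw [SNIEP.mem_P_iff hd1 hd0 hq]
    exact SNIEP.exists_isNormalizedSpectrum_iff (by linarith) hd0
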